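/- Let $n \in \mathbb{N}_0$ and let $p, q$ be integers with $q \geq p \geq 1$. Let $S$ be a compact topological space and let $f_s : \mathbb{R}^n \to \mathbb{R}$, $s \in S$, be $\mathcal{C}^{q+1}$ functions such that $f_s(x)$ and all partial derivatives of $f_s$ at $x$ up to order $q+1$ depend continuously on $(s,x) \in S \times \mathbb{R}^n$. Let $f(x) = \max_{s \in S} f_s(x)$ for all $x \in \mathbb{R}^n$ (in particular, the maximum is attained), and for each $y \in \mathbb{R}^n$ let $s(y) \in S$ be an index with $f_{s(y)}(y) = f(y)$. Write $\bar B_\Delta(x)$ for the closed Euclidean ball, and set $$\Lambda^p(x,\Delta) := \frac{f(x) - \min_{z \in \bar B_\Delta(x)} f(z)}{\Delta^p}, \qquad \mathcal{T}^{q,W}(z) := \max_{y \in W} \sum_{m=0}^q \frac{1}{m!} D^m f_{s(y)}(y)(z-y)^m$$ for $\Delta > 0$ and finite nonempty $W \subseteq \mathbb{R}^n$. Let $(\Delta_j)_{j \geq 1}$, $(\tau_j)_{j \geq 1}$ be sequences of positive reals that converge to $0$, let $\sigma \in (0,1)$, $c > 0$ and $x^0 \in \mathbb{R}^n$, and consider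 the following method. Start with $x^{1,0} = x^0$. For $j = 1, 2, \dots$ run the following inner loop over $i = 0, 1, \dots$: 1. Start with $W = \{x^{j,i}\}$. Compute any minimizer $\bar z$ of $\mathcal{T}^{q,W}$ over $\bar B_{\Delta_j}(x^{j,i})$. While $f(\bar z) - \mathcal{T}^{q,W}(\bar z) > \min(\Delta_j^{q+\sigma}, c)$, replace $W$ by $W \cup \{\bar z\}$ and compute any minimizer $\bar z$ for the new $W$. 2. With the last $\bar z$ computed in 1.: if $(f(x^{j,i}) - f(\bar z))/\Delta_j^p < \tau_j$, leave the inner loop and set $x^j := x^{j+1,0} := x^{j,i}$. Otherwise set $x^{j,i+1} := \bar z$ and continue the inner loop. Assume that the sublevel set $\{x \in \mathbb{R}^n : f(x) \leq f(x^0)\}$ is bounded. Then the method is well-defined: it can be carried out, and for every choice of the minimizers $\bar z$ all loops in step 1 and all inner loops are finite, so that it generates an infinite sequence $(x^j)_{j \geq 1}$. Every sequence generated in this way satisfies $$\lim_{j \to \infty} \Lambda^p(x^j,\Delta_j) = 0.$$ Furthermore, $(x^j)_j$ has an accumulation point, and every accumulation point $\bar x$ of $(x^j)_j$ is a critical point of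 $f$, i.e., $0 \in \partial f(\bar x)$, where $\partial f(\bar x)$ is the Clarke subdifferential, $\partial f(\bar x) = \{ g \in \mathbb{R}^n : \langle g, v \rangle \leq \limsup_{y \to \bar x,\, t \downarrow 0} (f(y+tv)-f(y))/t \ \text{for all } v \in \mathbb{R}^n \}$. -/

import Mathlib

open Filter Topology

noncomputable section

namespace TRBundle

/-- Euclidean space `ℝⁿ` with the Euclidean norm. -/
abbrev Rn (n : ℕ) : Type := EuclideanSpace ℝ (Fin n)

/-- The generalized directional derivative of Clarke,
`f°(x; v) = limsup_{y → x, t ↓ 0} (f (y + t v) - f y) / t`, taken in the extended reals so that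
no boundedness is needed for it to make sense. -/
def clarkeDeriv {n : ℕ} (f : Rn n → ℝ) (x v : Rn n) : EReal :=
  limsup (fun a : Rn n × ℝ => (((f (a.1 + a.2 • v) - f a.1) / a.2 : ℝ) : EReal))
    (𝓝 x ×ˢ 𝓝[>] (0 : ℝ))

/-- The Clarke subdifferential `∂f(x) = {g : ⟨g, v⟩ ≤ f°(x; v) for all v}`. -/
def clarkeSubdiff {n : ℕ} (f : Rn n → ℝ) (x : Rn n) : Set (Rn n) :=
  {g | ∀ v : Rn n, ((inner ℝ g v : ℝ) : EReal) ≤ clarkeDeriv f x v}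

/-- `x` is a (Clarke) critical point of `f`. -/
def IsCritical {n : ℕ} (f : Rn n → ℝ) (x : Rn n) : Prop :=
  (0 : Rn n) ∈ clarkeSubdiff f x

/-- `f` is the pointwise maximum of the `C^{q+1}` selection functions `φ s`, `s ∈ S`, whose values
and derivatives up to order `q + 1` depend continuously on `(s, x)`. (The `m`-th derivative is an
`m`-linear form on `ℝⁿ`, with the partial derivatives of order `m` as its coefficients; it is
continuous in `(s, x)` iff all of these are.) Compactness of `S` is required separately. -/
structure IsMaxRepr {n : ℕ} {S : Type*} [TopologicalSpace S] (q : ℕ)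
    (φ : S → Rn n → ℝ) (f : Rn n → ℝ) : Prop where
  contDiff : ∀ s, ContDiff ℝ (q + 1) (φ s)
  continuous_deriv : ∀ m : ℕ, m ≤ q + 1 →
    Continuous fun a : S × Rn n => iteratedFDeriv ℝ m (φ a.1) a.2
  isGreatest : ∀ x, IsGreatest (Set.range fun s => φ s x) (f x)

/-- `s x` is an active index at every point `x`. -/
def IsActiveSelection {n : ℕ} {S : Type*} (φ : S → Rn n → ℝ) (f : Rn n → ℝ)
    (s : Rn n → S) : Prop :=
  ∀ x, φ (s x) x = f x

/-- `Λ^p(x, Δ) = (f x - min_{z ∈ B̄_Δ(x)} f z) / Δ^p`. -/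
def Lam {n : ℕ} (f : Rn n → ℝ) (p : ℕ) (x : Rn n) (Δ : ℝ) : ℝ :=
  (f x - sInf (f '' Metric.closedBall x Δ)) / Δ ^ p

/-- `Λ^p(x, Δ)` is computed by any minimizer of `f` in the trust region. -/
theorem Lam_eq {n : ℕ} {f : Rn n → ℝ} {p : ℕ} {x z : Rn n} {Δ : ℝ}
    (hz : z ∈ Metric.closedBall x Δ) (hmin : IsMinOn f (Metric.closedBall x Δ) z) :
    Lam f p x Δ = (f x - f z) / Δ ^ p := by
  have h : IsLeast (f '' Metric.closedBall x Δ) (f z) :=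
    ⟨⟨z, hz, rfl⟩, by rintro _ ⟨y, hy, rfl⟩; exact hmin hy⟩
  rw [Lam, h.csInf_eq]

/-- The Taylor polynomial of order `q` of `g` at `y`, evaluated at `z`:
`T^q g(z, y) = ∑_{m ≤ q} D^m g(y)(z - y)^m / m!`. -/
def taylorPoly {n : ℕ} (q : ℕ) (g : Rn n → ℝ) (z y : Rn n) : ℝ :=
  ∑ m ∈ Finset.range (q + 1),
    ((m.factorial : ℝ))⁻¹ * iteratedFDeriv ℝ m g y (fun _ => z - y)

/-- The `q`-order cutting-plane model for the bundle `W`: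
`𝒯^{q,W}(z) = max_{y ∈ W} T^q f_{s(y)}(z, y)` (for finite nonempty `W`). -/
def model {n : ℕ} {S : Type*} (q : ℕ) (φ : S → Rn n → ℝ) (s : Rn n → S)
    (W : Finset (Rn n)) (z : Rn n) : ℝ :=
  ⨆ y : W, taylorPoly q (φ (s y)) z y

/-- `z` is a solution of the trust-region subproblem `min_{z ∈ B̄_Δ(x)} 𝒯^{q,W}(z)`. -/
def IsSubproblemSol {n : ℕ} {S : Type*} (q : ℕ) (φ : S → Rn n → ℝ) (s : Rn n → S)
    (W : Finset (Rn n)) (x : Rn n) (Δ : ℝ) (z : Rn n) : Prop :=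
  z ∈ Metric.closedBall x Δ ∧ IsMinOn (model q φ s W) (Metric.closedBall x Δ) z

/-- Stopping criterion of the bundle subroutine, at a solution `z` of the subproblem for `W`:
`f(z) - 𝒯^{q,W}(z) ≤ min (Δ^{q+σ}, c)`. -/
def ModelAccurate {n : ℕ} {S : Type*} (q : ℕ) (φ : S → Rn n → ℝ) (s : Rn n → S)
    (f : Rn n → ℝ) (σ c Δ : ℝ) (W : Finset (Rn n)) (z : Rn n) : Prop :=
  f z - model q φ s W z ≤ min (Δ ^ ((q : ℝ) + σ)) c

/-- State of the trust-region bundle method: the outer index `j`, the current iterate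
`x = x^{j,i}`, and the current bundle `W` of the subroutine that is running at `x^{j,i}`. -/
structure State (n : ℕ) where
  j : ℕ
  x : Rn n
  W : Finset (Rn n)

open Classical in
/-- One step of the method. A solution `z` of the subproblem for the current bundle is computed.
* If the stopping criterion of the subroutine fails at `z`, then `z` is added to the bundle.
* Otherwise the subroutine has returned `W` and `z`. If `(f x - f z) / Δ_j^p < τ_j`, the inner loop
  is left: the next outer iteration starts at the same point `x`, which is `x^j`.
* Otherwise `z` is the next inner iterate.

In the last two cases the subroutine restarts with the bundle that consists of the iterate only. -/
def Step {n : ℕ} {S : Type*} (p q : ℕ) (φ : S → Rn n → ℝ) (s : Rn n → S) (f : Rn n → ℝ)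
    (σ c : ℝ) (Δ τ : ℕ → ℝ) (a b : State n) : Prop :=
  ∃ z, IsSubproblemSol q φ s a.W a.x (Δ a.j) z ∧
    ((¬ ModelAccurate q φ s f σ c (Δ a.j) a.W z ∧ b = ⟨a.j, a.x, insert z a.W⟩) ∨
     (ModelAccurate q φ s f σ c (Δ a.j) a.W z ∧
        (f a.x - f z) / Δ a.j ^ p < τ a.j ∧ b = ⟨a.j + 1, a.x, {a.x}⟩) ∨
     (ModelAccurate q φ s f σ c (Δ a.j) a.W z ∧
        ¬ (f a.x - f z) / Δ a.j ^ p < τ a.j ∧ b = ⟨a.j, z, {z}⟩))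

/-- `e` is an execution of the method from the initial point `x⁰ = x^{1,0}`: it starts in outer
iteration `1` with the bundle `{x⁰}`, and goes on forever. -/
def IsExecution {n : ℕ} {S : Type*} (p q : ℕ) (φ : S → Rn n → ℝ) (s : Rn n → S)
    (f : Rn n → ℝ) (σ c : ℝ) (Δ τ : ℕ → ℝ) (x₀ : Rn n) (e : ℕ → State n) : Prop :=
  e 0 = ⟨1, x₀, {x₀}⟩ ∧ ∀ t, Step p q φ s f σ c Δ τ (e t) (e (t + 1))

/-- `y` is the outer iterate `x^j` of the execution `e`: the iterate at which the inner loop of the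
`j`-th outer iteration is left. -/
def IsOuterIterate {n : ℕ} (e : ℕ → State n) (j : ℕ) (y : Rn n) : Prop :=
  ∃ t, (e t).j = j ∧ (e (t + 1)).j = j + 1 ∧ (e t).x = y

end TRBundle

end
/-!
Each null step adds to the bundle a point at which the model underestimates `f` by a fixed amount,
while every bundle point already gives an accurate model near itself. So the added points stay
a fixed distance apart, and compactness of the trust region stops the subroutine. Every other inner
step lowers `f` by at least `τ_j Δ_j^p`, and `f` is bounded below, so every inner loop ends.

When it ends, Taylor's theorem shows that the final model exceeds `f` by `O(Δ_j^{q+1})` on the trust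
region, while at its minimizer it is at most `Δ_j^{q+σ}` below `f`. This minimizer is therefore
almost a minimizer of `f`, and `Λ^p(x^j, Δ_j) ≤ τ_j + O(Δ_j^{q+σ-p} + Δ_j^{q+1-p})`. Finally,
`-Λ^p` bounds the difference quotients of `f` with step lengths proportional to `Δ_j` from below, up
to a constant factor, so Clarke's directional derivatives at accumulation points are nonnegative.
-/

namespace TRBundle

open Metric Set

open scoped NNReal

section General

theorem norm_sub_sum_iteratedFDeriv_le {E F : Type*} [NormedAddCommGroup E] [NormedSpace ℝ E]
    [NormedAddCommGroup F] [NormedSpace ℝ F] [CompleteSpace F] {q : ℕ} {g : E → F} {y z : E} {C : ℝ}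
    (hg : ∀ x ∈ segment ℝ y z, ContDiffAt ℝ (q + 1) g x)
    (hC : ∀ x ∈ segment ℝ y z, ‖iteratedFDeriv ℝ (q + 1) g x‖ ≤ C) :
    ‖g z - ∑ m ∈ Finset.range (q + 1),
        ((m.factorial : ℝ))⁻¹ • iteratedFDeriv ℝ m g y (fun _ => z - y)‖ ≤
      C * ‖z - y‖ ^ (q + 1) := by
  have hseg : ∀ t ∈ Icc (0 : ℝ) 1, y + t • (z - y) ∈ segment ℝ y z := fun t ht =>
    segment_eq_image' ℝ y z ▸ mem_image_of_mem _ ht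
  have hremainder : ∀ t ∈ uIoc (0 : ℝ) 1,
      ‖(1 - t) ^ q • iteratedFDeriv ℝ (q + 1) g (y + t • (z - y)) (fun _ => z - y)‖ ≤
        C * ‖z - y‖ ^ (q + 1) := by
    intro t ht
    rw [uIoc_of_le zero_le_one] at ht
    have hpow : ‖(1 - t) ^ q‖ ≤ 1 := by
      rw [Real.norm_of_nonneg (pow_nonneg (sub_nonneg.2 ht.2) q)]
      exact pow_le_one₀ (sub_nonneg.2 ht.2) (sub_le_self 1 ht.1.le)
    rw [norm_smul]
    refine (mul_le_of_le_one_left (norm_nonneg _) hpow).trans ?_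
    simpa using (iteratedFDeriv ℝ (q + 1) g _).le_of_opNorm_le (hC _ (hseg t ⟨ht.1.le, ht.2⟩))
      fun _ => z - y
  have htaylor := map_add_eq_sum_add_integral_iteratedFDeriv (y := z - y)
    fun t ht => hg _ (hseg t ht)
  rw [add_sub_cancel] at htaylor
  rw [sub_eq_of_eq_add' htaylor, norm_smul, norm_inv, Real.norm_natCast]
  have hintegral := intervalIntegral.norm_integral_le_of_norm_le_const hremainder
  rw [sub_zero, abs_one, mul_one] at hintegral
  exact (mul_le_of_le_one_left (norm_nonneg _)
    (inv_le_one_of_one_le₀ (mod_cast q.factorial_pos))).trans hintegral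

theorem lipschitzOnWith_of_isGreatest {α ι : Type*} [PseudoMetricSpace α] {φ : ι → α → ℝ}
    {f : α → ℝ} {K : Set α} {L : ℝ≥0} (hφ : ∀ i, LipschitzOnWith L (φ i) K)
    (hf : ∀ x ∈ K, IsGreatest (range fun i => φ i x) (f x)) : LipschitzOnWith L f K := by
  refine .of_le_add_mul L fun x hx y hy => ?_
  obtain ⟨i, hi : φ i x = f x⟩ := (hf x hx).1
  calc f x = φ i x := hi.symm
    _ ≤ φ i y + L * dist x y := (hφ i).le_add_mul hx hy
    _ ≤ f y + L * dist x y := by gcongr; exact (hf y hy).2 ⟨i, rfl⟩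

theorem bddBelow_range_of_isBounded_sublevel {α : Type*} [PseudoMetricSpace α] [ProperSpace α]
    {f : α → ℝ} (hf : Continuous f) {x₀ : α} (hbdd : Bornology.IsBounded {x | f x ≤ f x₀}) :
    BddBelow (range f) := by
  have hfar : ∀ᶠ x in cocompact α, f x₀ ≤ f x := by
    rw [← cobounded_eq_cocompact]
    filter_upwards [Bornology.isBounded_def.1 hbdd] with x hx using
      (le_total (f x) (f x₀)).resolve_left hx
  obtain ⟨x, hx⟩ := hf.exists_forall_le' x₀ hfar
  exact ⟨f x, forall_mem_range.2 hx⟩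

theorem exists_lt_dist_lt_of_isCompact {α : Type*} [PseudoMetricSpace α] {K : Set α}
    (hK : IsCompact K) {u : ℕ → α} (hu : ∀ k, u k ∈ K) {δ : ℝ} (hδ : 0 < δ) :
    ∃ k l, k < l ∧ dist (u l) (u k) < δ := by
  obtain ⟨_, -, ψ, hψ, hlim⟩ := hK.tendsto_subseq hu
  obtain ⟨N, hN⟩ := Metric.cauchySeq_iff.1 hlim.cauchySeq δ hδ
  exact ⟨ψ N, ψ (N + 1), hψ N.lt_succ_self, hN _ N.le_succ _ le_rfl⟩

theorem eventually_sub_lt_succ_of_antitone {u : ℕ → ℝ} (hu : Antitone u) (hb : BddBelow (range u))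
    {δ : ℝ} (hδ : 0 < δ) : ∀ᶠ k in atTop, u k - δ < u (k + 1) := by
  have hlim := tendsto_atTop_ciInf hu hb
  have hdiff : Tendsto (fun k => u k - u (k + 1)) atTop (𝓝 0) := by
    simpa using hlim.sub (hlim.comp (tendsto_add_atTop_nat 1))
  filter_upwards [hdiff.eventually_lt_const hδ] with k hk
  linarith

theorem existsUnique_eq_and_succ_eq {u : ℕ → ℕ} (hstep : ∀ t, u (t + 1) = u t ∨ u (t + 1) = u t + 1)
    (hconst : ∀ N, ¬ ∀ t ≥ N, u t = u N) {k : ℕ} (hk : u 0 ≤ k) :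
    ∃! t, u t = k ∧ u (t + 1) = k + 1 := by
  have hmono : Monotone u := monotone_nat_of_le_succ fun t => by grind
  have hexceeds : ∃ t, k < u t := by
    by_contra! hle
    obtain ⟨b, N, hN⟩ := converges_of_monotone_of_bounded hmono hle
    exact hconst N fun t ht => (hN t ht).trans (hN N le_rfl).symm
  obtain ⟨t, hlast, hfirst⟩ := Nat.exists_not_and_succ_of_not_zero_of_exists
    (p := fun t => k < u t) hk.not_gt hexceeds
  refine ⟨t, by grind, fun t' ht' => le_antisymm ?_ ?_⟩
  · by_contra! h
    have := hmono (Nat.succ_le_of_lt h)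
    grind
  · by_contra! h
    have := hmono (Nat.succ_le_of_lt h)
    grind

end General

section Criticality

variable {n p : ℕ} {f : Rn n → ℝ}

theorem div_le_Lam (hf : Continuous f) {x z : Rn n} {Δ : ℝ} (hz : z ∈ closedBall x Δ) :
    (f x - f z) / Δ ^ p ≤ Lam f p x Δ := by
  have hΔ : 0 ≤ Δ := dist_nonneg.trans hz
  have hinf : sInf (f '' closedBall x Δ) ≤ f z :=
    csInf_le ((isCompact_closedBall x Δ).image hf).bddBelow (mem_image_of_mem f hz)
  unfold Lam
  gcongr

theorem Lam_nonneg (hf : Continuous f) (x : Rn n) {Δ : ℝ} (hΔ : 0 ≤ Δ) : 0 ≤ Lam f p x Δ := by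
  simpa using div_le_Lam (p := p) hf (mem_closedBall_self (x := x) hΔ)

theorem Lam_le_div (hf : Continuous f) {x : Rn n} {Δ b : ℝ} (hΔ : 0 ≤ Δ)
    (hb : ∀ w ∈ closedBall x Δ, b ≤ f w) : Lam f p x Δ ≤ (f x - b) / Δ ^ p := by
  obtain ⟨w, hw, hmin⟩ := (isCompact_closedBall x Δ).exists_isMinOn
    ⟨x, mem_closedBall_self hΔ⟩ hf.continuousOn
  rw [Lam_eq hw hmin]
  gcongr
  exact hb w hw

theorem le_clarkeDeriv_of_tendsto {ι : Type*} {l : Filter ι} [l.NeBot] {x : ι → Rn n} {t b : ι → ℝ}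
    {a v : Rn n} {r : ℝ} (hx : Tendsto x l (𝓝 a)) (ht : Tendsto t l (𝓝[>] 0))
    (hb : Tendsto b l (𝓝 r)) (hle : ∀ᶠ i in l, b i ≤ (f (x i + t i • v) - f (x i)) / t i) :
    (r : EReal) ≤ clarkeDeriv f a v :=
  calc (r : EReal) = limsup (fun i => (b i : EReal)) l :=
        ((continuous_coe_real_ereal.tendsto r).comp hb).limsup_eq.symm
    _ ≤ limsup (fun i => (((f (x i + t i • v) - f (x i)) / t i : ℝ) : EReal)) l :=
        limsup_le_limsup (hle.mono fun _ hi => EReal.coe_le_coe_iff.2 hi)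
    _ ≤ clarkeDeriv f a v := limsup_le_limsup_of_le
        (u := fun y : Rn n × ℝ => (((f (y.1 + y.2 • v) - f y.1) / y.2 : ℝ) : EReal))
        (hx.prodMk ht)

theorem neg_mul_Lam_le_slope (hf : Continuous f) (hp : 1 ≤ p) (x v : Rn n) {Δ : ℝ} (hΔ₀ : 0 < Δ)
    (hΔ₁ : Δ ≤ 1) :
    -((‖v‖ + 1) * Lam f p x Δ) ≤
      (f (x + (Δ / (‖v‖ + 1)) • v) - f x) / (Δ / (‖v‖ + 1)) := by
  have hv : 0 < ‖v‖ + 1 := by positivity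
  set t := Δ / (‖v‖ + 1) with ht
  have ht₀ : 0 < t := div_pos hΔ₀ hv
  have hmem : x + t • v ∈ closedBall x Δ := by
    rw [mem_closedBall, dist_self_add_left, norm_smul, Real.norm_of_nonneg ht₀.le, ht,
      div_mul_eq_mul_div, div_le_iff₀ hv]
    gcongr
    exact (lt_add_one _).le
  have hdecrease : f x - f (x + t • v) ≤ Lam f p x Δ * Δ :=
    calc f x - f (x + t • v) ≤ Lam f p x Δ * Δ ^ p :=
          (div_le_iff₀ (pow_pos hΔ₀ p)).1 (div_le_Lam hf hmem)
      _ ≤ Lam f p x Δ * Δ := by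
          gcongr
          exacts [Lam_nonneg hf x hΔ₀.le, pow_le_of_le_one hΔ₀.le hΔ₁ (Nat.one_le_iff_ne_zero.1 hp)]
  have hΔt : Δ = (‖v‖ + 1) * t := (mul_div_cancel₀ Δ hv.ne').symm
  rw [le_div_iff₀ ht₀]
  linear_combination hdecrease + Lam f p x Δ * hΔt

theorem isCritical_of_tendsto_Lam {ι : Type*} {l : Filter ι} {x : ι → Rn n} {Δ : ι → ℝ} {a : Rn n}
    (hf : Continuous f) (hp : 1 ≤ p) (hΔ : Tendsto Δ l (𝓝[>] 0))
    (hLam : Tendsto (fun i => Lam f p (x i) (Δ i)) l (𝓝 0)) (ha : MapClusterPt a l x) :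
    IsCritical f a := by
  intro v
  obtain ⟨U, hUl, hUx⟩ := mapClusterPt_iff_ultrafilter.1 ha
  rw [tendsto_nhdsWithin_iff] at hΔ
  have hv : 0 < ‖v‖ + 1 := by positivity
  have hstep : Tendsto (fun i => Δ i / (‖v‖ + 1)) l (𝓝[>] 0) := by
    refine tendsto_nhdsWithin_iff.2 ⟨?_, hΔ.2.mono fun i hi => div_pos hi hv⟩
    simpa using hΔ.1.div_const (‖v‖ + 1)
  have hbound : Tendsto (fun i => -((‖v‖ + 1) * Lam f p (x i) (Δ i))) l (𝓝 0) := by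
    simpa using (hLam.const_mul (‖v‖ + 1)).neg
  rw [inner_zero_left]
  refine le_clarkeDeriv_of_tendsto hUx (hstep.mono_left hUl) (hbound.mono_left hUl) (hUl ?_)
  filter_upwards [hΔ.2, hΔ.1.eventually_le_const one_pos] with i hi₀ hi₁
  exact neg_mul_Lam_le_slope hf hp (x i) v hi₀ hi₁

end Criticality

section MaxRepr

variable {n q : ℕ} {S : Type*} {φ : S → Rn n → ℝ} {f : Rn n → ℝ} {s : Rn n → S} {K : Set (Rn n)}

/-- `C` is a constant in Taylor's theorem of order `q` that serves all functions of the family `φ`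
and all centers and arguments in `K` at once. For `q = 0` it is a common Lipschitz constant. -/
def IsTaylorConst (q : ℕ) (φ : S → Rn n → ℝ) (K : Set (Rn n)) (C : ℝ≥0) : Prop :=
  ∀ s, ∀ y ∈ K, ∀ z ∈ K, |φ s z - taylorPoly q (φ s) z y| ≤ C * dist z y ^ (q + 1)

theorem isTaylorConst_zero_iff {L : ℝ≥0} :
    IsTaylorConst 0 φ K L ↔ ∀ s, LipschitzOnWith L (φ s) K := by
  simp only [IsTaylorConst, taylorPoly, lipschitzOnWith_iff_dist_le_mul, Real.dist_eq, zero_add,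
    Finset.range_one, Finset.sum_singleton, Nat.factorial_zero, Nat.cast_one, inv_one, one_mul,
    iteratedFDeriv_zero_apply, pow_one]
  exact forall_congr' fun s => ⟨fun h z hz y hy => h y hy z hz, fun h y hy z hz => h z hz y hy⟩

theorem continuous_taylorPoly (q : ℕ) (g : Rn n → ℝ) (y : Rn n) :
    Continuous fun z => taylorPoly q g z y :=
  continuous_finsetSum _ fun m _ => continuous_const.mul <|
    (iteratedFDeriv ℝ m g y).cont.comp <| continuous_pi fun _ => continuous_id.sub continuous_const

variable [TopologicalSpace S]

theorem IsMaxRepr.of_le (hf : IsMaxRepr q φ f) {r : ℕ} (hr : r ≤ q) : IsMaxRepr r φ f where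
  contDiff s := (hf.contDiff s).of_le (by gcongr)
  continuous_deriv m hm := hf.continuous_deriv m (by lia)
  isGreatest := hf.isGreatest

theorem IsMaxRepr.le (hf : IsMaxRepr q φ f) (s : S) (x : Rn n) : φ s x ≤ f x :=
  (hf.isGreatest x).2 ⟨s, rfl⟩

variable [CompactSpace S]

theorem IsMaxRepr.exists_isTaylorConst (hf : IsMaxRepr q φ f) (hK : IsCompact K)
    (hconv : Convex ℝ K) : ∃ C, IsTaylorConst q φ K C := by
  obtain ⟨C, hC⟩ := (isCompact_univ.prod hK).exists_bound_of_continuousOn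
    (hf.continuous_deriv (q + 1) le_rfl).continuousOn
  refine ⟨C.toNNReal, fun s y hy z hz => ?_⟩
  rw [dist_eq_norm]
  exact norm_sub_sum_iteratedFDeriv_le (fun x _ => (hf.contDiff s).contDiffAt)
    fun x hx => (hC (s, x) ⟨mem_univ s, hconv.segment_subset hy hz hx⟩).trans C.le_coe_toNNReal

theorem IsMaxRepr.exists_lipschitzOnWith (hf : IsMaxRepr q φ f) (hK : IsCompact K)
    (hconv : Convex ℝ K) :
    ∃ L, (∀ s, LipschitzOnWith L (φ s) K) ∧ LipschitzOnWith L f K := by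
  obtain ⟨L, hL⟩ := (hf.of_le q.zero_le).exists_isTaylorConst hK hconv
  have hφ := isTaylorConst_zero_iff.1 hL
  exact ⟨L, hφ, lipschitzOnWith_of_isGreatest hφ fun x _ => hf.isGreatest x⟩

theorem IsMaxRepr.locallyLipschitz (hf : IsMaxRepr q φ f) : LocallyLipschitz f := fun x =>
  have ⟨L, _, hL⟩ := hf.exists_lipschitzOnWith (isCompact_closedBall x 1) (convex_closedBall x 1)
  ⟨L, _, closedBall_mem_nhds x one_pos, hL⟩

theorem IsMaxRepr.exists_forall_dist_lt_sub_taylorPoly_lt (hf : IsMaxRepr q φ f)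
    (hs : IsActiveSelection φ f s) (hK : IsCompact K) (hconv : Convex ℝ K) {ε : ℝ} (hε : 0 < ε) :
    ∃ δ > 0, ∀ y ∈ K, ∀ z ∈ K, dist z y < δ → f z - taylorPoly q (φ (s y)) z y < ε := by
  obtain ⟨C, hC⟩ := hf.exists_isTaylorConst hK hconv
  obtain ⟨L, hφL, hfL⟩ := hf.exists_lipschitzOnWith hK hconv
  have hlim : Tendsto (fun d : ℝ => 2 * L * d + C * d ^ (q + 1)) (𝓝 0) (𝓝 0) :=
    Continuous.tendsto' (by fun_prop) _ _ (by simp)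
  obtain ⟨δ, hδ, hsmall⟩ := Metric.eventually_nhds_iff.1 (hlim.eventually_lt_const hε)
  refine ⟨δ, hδ, fun y hy z hz hdist => ?_⟩
  have hmodulus := hsmall (y := dist z y) (by simpa using hdist)
  have hf_le : f z ≤ f y + L * dist z y := hfL.le_add_mul hz hy
  have hφ_le : φ (s y) y ≤ φ (s y) z + L * dist z y := dist_comm z y ▸ (hφL _).le_add_mul hy hz
  have htaylor := (abs_le.1 (hC (s y) y hy z hz)).2
  linarith [hs y]

end MaxRepr

section Model

variable {n q : ℕ} {S : Type*} {φ : S → Rn n → ℝ} {f : Rn n → ℝ} {s : Rn n → S}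
  {W : Finset (Rn n)}

theorem taylorPoly_le_model {y : Rn n} (hy : y ∈ W) (z : Rn n) :
    taylorPoly q (φ (s y)) z y ≤ model q φ s W z :=
  le_ciSup (f := fun y : W => taylorPoly q (φ (s y)) z y) (finite_range _).bddAbove ⟨y, hy⟩

theorem model_le (hW : W.Nonempty) {z : Rn n} {b : ℝ}
    (h : ∀ y ∈ W, taylorPoly q (φ (s y)) z y ≤ b) : model q φ s W z ≤ b :=
  have := hW.to_subtype
  ciSup_le fun y => h y y.2

theorem continuous_model (hW : W.Nonempty) : Continuous (model q φ s W) := by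
  have := hW.to_subtype
  have hsup : model q φ s W = fun z => Finset.univ.sup' Finset.univ_nonempty
      fun y : W => taylorPoly q (φ (s y)) z y :=
    funext fun z => (Finset.sup'_univ_eq_ciSup _).symm
  rw [hsup]
  exact Continuous.finset_sup'_apply _ fun y _ => continuous_taylorPoly q (φ (s y)) y

theorem exists_isSubproblemSol (hW : W.Nonempty) (x : Rn n) {Δ : ℝ} (hΔ : 0 ≤ Δ) :
    ∃ z, IsSubproblemSol q φ s W x Δ z :=
  (isCompact_closedBall x Δ).exists_isMinOn ⟨x, mem_closedBall_self hΔ⟩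
    (continuous_model hW).continuousOn

variable [TopologicalSpace S] {K : Set (Rn n)} {C : ℝ≥0} {x z w : Rn n} {σ c Δ : ℝ}

theorem IsMaxRepr.model_le_add (hf : IsMaxRepr q φ f) (hC : IsTaylorConst q φ K C)
    (hK : closedBall x Δ ⊆ K) (hW : W.Nonempty) (hWΔ : ∀ y ∈ W, y ∈ closedBall x Δ)
    (hw : w ∈ closedBall x Δ) : model q φ s W w ≤ f w + C * (2 * Δ) ^ (q + 1) := by
  refine model_le hW fun y hy => ?_
  have hdist : dist w y ≤ 2 * Δ :=
    (dist_triangle_right w y x).trans ((add_le_add hw (hWΔ y hy)).trans_eq (two_mul Δ).symm)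
  calc taylorPoly q (φ (s y)) w y ≤ φ (s y) w + C * dist w y ^ (q + 1) := by
        linarith [(abs_le.1 (hC (s y) y (hK (hWΔ y hy)) w (hK hw))).1]
    _ ≤ f w + C * (2 * Δ) ^ (q + 1) := by
        gcongr
        exact hf.le (s y) w

theorem IsSubproblemSol.apply_le_add (hz : IsSubproblemSol q φ s W x Δ z)
    (hacc : ModelAccurate q φ s f σ c Δ W z) (hf : IsMaxRepr q φ f) (hC : IsTaylorConst q φ K C)
    (hK : closedBall x Δ ⊆ K) (hW : W.Nonempty) (hWΔ : ∀ y ∈ W, y ∈ closedBall x Δ)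
    (hw : w ∈ closedBall x Δ) :
    f z ≤ f w + (Δ ^ ((q : ℝ) + σ) + C * (2 * Δ) ^ (q + 1)) :=
  calc f z ≤ model q φ s W z + Δ ^ ((q : ℝ) + σ) :=
        sub_le_iff_le_add'.1 (hacc.trans (min_le_left _ _))
    _ ≤ model q φ s W w + Δ ^ ((q : ℝ) + σ) := by gcongr; exact hz.2 hw
    _ ≤ f w + C * (2 * Δ) ^ (q + 1) + Δ ^ ((q : ℝ) + σ) := by
        gcongr; exact hf.model_le_add hC hK hW hWΔ hw
    _ = f w + (Δ ^ ((q : ℝ) + σ) + C * (2 * Δ) ^ (q + 1)) := by ring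

end Model

section Steps

variable {n p q : ℕ} {S : Type*} {φ : S → Rn n → ℝ} {s : Rn n → S} {f : Rn n → ℝ}
  {σ c : ℝ} {Δ τ : ℕ → ℝ} {a b : State n}

/-- The invariant of the method: the outer index is at least `1`, and the current bundle contains
the iterate and lies in the trust region around it. -/
structure State.Valid (Δ : ℕ → ℝ) (a : State n) : Prop where
  one_le : 1 ≤ a.j
  mem : a.x ∈ a.W
  mem_closedBall : ∀ y ∈ a.W, y ∈ closedBall a.x (Δ a.j)

open Classical in
/-- A null step: the model is inaccurate at some point `z` of the trust region, which is added to
the bundle. In contrast to `Step`, the point `z` need not minimize the model. -/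
def IsNullStep (q : ℕ) (φ : S → Rn n → ℝ) (s : Rn n → S) (f : Rn n → ℝ) (σ c : ℝ) (Δ : ℕ → ℝ)
    (a b : State n) : Prop :=
  ∃ z ∈ closedBall a.x (Δ a.j), ¬ ModelAccurate q φ s f σ c (Δ a.j) a.W z ∧
    b = ⟨a.j, a.x, insert z a.W⟩

theorem State.valid_singleton {j : ℕ} (hj : 1 ≤ j) (hΔ : 0 ≤ Δ j) (x : Rn n) :
    (⟨j, x, {x}⟩ : State n).Valid Δ where
  one_le := hj
  mem := Finset.mem_singleton_self x
  mem_closedBall _ hy := Finset.mem_singleton.1 hy ▸ mem_closedBall_self hΔ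

theorem State.Valid.exists_step (ha : a.Valid Δ) (hΔ : 0 ≤ Δ a.j) :
    ∃ b, Step p q φ s f σ c Δ τ a b := by
  obtain ⟨z, hz⟩ := exists_isSubproblemSol (q := q) (φ := φ) (s := s) ⟨_, ha.mem⟩ a.x hΔ
  by_cases hacc : ModelAccurate q φ s f σ c (Δ a.j) a.W z
  · by_cases hexit : (f a.x - f z) / Δ a.j ^ p < τ a.j
    exacts [⟨_, z, hz, .inr (.inl ⟨hacc, hexit, rfl⟩)⟩, ⟨_, z, hz, .inr (.inr ⟨hacc, hexit, rfl⟩)⟩]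
  · exact ⟨_, z, hz, .inl ⟨hacc, rfl⟩⟩

theorem Step.valid (h : Step p q φ s f σ c Δ τ a b) (hΔpos : ∀ j, 1 ≤ j → 0 < Δ j)
    (ha : a.Valid Δ) : b.Valid Δ := by
  obtain ⟨z, hz, ⟨-, rfl⟩ | ⟨-, -, rfl⟩ | ⟨-, -, rfl⟩⟩ := h
  · exact ⟨ha.one_le, Finset.mem_insert_of_mem ha.mem,
      Finset.forall_mem_insert _ _ _ |>.2 ⟨hz.1, ha.mem_closedBall⟩⟩
  · have hj := Nat.le_succ_of_le ha.one_le
    exact State.valid_singleton hj (hΔpos _ hj).le a.x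
  · exact State.valid_singleton ha.one_le (hΔpos _ ha.one_le).le z

theorem Step.j_eq_or (h : Step p q φ s f σ c Δ τ a b) : b.j = a.j ∨ b.j = a.j + 1 := by
  obtain ⟨_, _, ⟨-, rfl⟩ | ⟨-, -, rfl⟩ | ⟨-, -, rfl⟩⟩ := h
  exacts [.inl rfl, .inr rfl, .inl rfl]

theorem Step.isNullStep_or_apply_le_sub (h : Step p q φ s f σ c Δ τ a b) (hΔ : 0 < Δ a.j)
    (hj : b.j = a.j) :
    IsNullStep q φ s f σ c Δ a b ∨ f b.x ≤ f a.x - τ a.j * Δ a.j ^ p := by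
  obtain ⟨z, hz, ⟨hacc, rfl⟩ | ⟨-, -, rfl⟩ | ⟨-, hdecrease, rfl⟩⟩ := h
  · exact .inl ⟨z, hz.1, hacc, rfl⟩
  · simp at hj
  · rw [not_lt, le_div_iff₀ (pow_pos hΔ p)] at hdecrease
    exact .inr (le_sub_comm.1 hdecrease)

theorem Step.exists_modelAccurate_of_succ (h : Step p q φ s f σ c Δ τ a b) (hj : b.j = a.j + 1) :
    b.x = a.x ∧ ∃ z, IsSubproblemSol q φ s a.W a.x (Δ a.j) z ∧
      ModelAccurate q φ s f σ c (Δ a.j) a.W z ∧ (f a.x - f z) / Δ a.j ^ p < τ a.j := by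
  obtain ⟨z, hz, ⟨-, rfl⟩ | ⟨hacc, hexit, rfl⟩ | ⟨-, -, rfl⟩⟩ := h
  · simp at hj
  · exact ⟨rfl, z, hz, hacc, hexit⟩
  · simp at hj

theorem Step.apply_le (h : Step p q φ s f σ c Δ τ a b) (hΔ : 0 < Δ a.j) (hτ : 0 ≤ τ a.j) :
    f b.x ≤ f a.x := by
  rcases h.j_eq_or with hj | hj
  · rcases h.isNullStep_or_apply_le_sub hΔ hj with ⟨z, -, -, rfl⟩ | hle
    exacts [le_rfl, hle.trans (sub_le_self _ (by positivity))]
  · rw [(h.exists_modelAccurate_of_succ hj).1]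

theorem not_forall_isNullStep [TopologicalSpace S] [CompactSpace S] (hf : IsMaxRepr q φ f)
    (hs : IsActiveSelection φ f s) (hc : 0 < c) {a : ℕ → State n} (hΔ : 0 < Δ (a 0).j) :
    ¬ ∀ k, IsNullStep q φ s f σ c Δ (a k) (a (k + 1)) := by
  intro h
  choose z hz hacc hsucc using h
  have hj : ∀ k, (a k).j = (a 0).j := fun k => by
    induction k with
    | zero => rfl
    | succ k ih => rw [hsucc, ih]
  have hx : ∀ k, (a k).x = (a 0).x := fun k => by
    induction k with
    | zero => rfl
    | succ k ih => rw [hsucc, ih]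
  have hmono : Monotone fun k => (a k).W := monotone_nat_of_le_succ fun k => by
    rw [hsucc]
    exact Finset.subset_insert _ _
  have hmem : ∀ k l, k < l → z k ∈ (a l).W := fun k l hkl =>
    hmono (Nat.succ_le_of_lt hkl) (by simp [hsucc])
  have hball : ∀ k, z k ∈ closedBall (a 0).x (Δ (a 0).j) := fun k => by
    simpa only [hj, hx] using hz k
  set ε := min (Δ (a 0).j ^ ((q : ℝ) + σ)) c
  have hε : 0 < ε := lt_min (Real.rpow_pos_of_pos hΔ _) hc
  have hcompact := isCompact_closedBall (a 0).x (Δ (a 0).j)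
  obtain ⟨δ, hδ, hnear⟩ :=
    hf.exists_forall_dist_lt_sub_taylorPoly_lt hs hcompact (convex_closedBall _ _) hε
  obtain ⟨k, l, hkl, hdist⟩ := exists_lt_dist_lt_of_isCompact hcompact hball hδ
  refine hacc l ?_
  rw [ModelAccurate, hj]
  linarith [hnear _ (hball k) _ (hball l) hdist,
    taylorPoly_le_model (q := q) (φ := φ) (s := s) (hmem k l hkl) (z l)]

end Steps

section Execution

variable {n p q : ℕ} {S : Type*} {φ : S → Rn n → ℝ} {s : Rn n → S} {f : Rn n → ℝ}
  {σ c : ℝ} {Δ τ : ℕ → ℝ} {x₀ : Rn n} {e : ℕ → State n}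

theorem exists_isExecution (hΔpos : ∀ j, 1 ≤ j → 0 < Δ j) :
    ∃ e, IsExecution p q φ s f σ c Δ τ x₀ e := by
  choose next hnext using fun a : {a : State n // a.Valid Δ} =>
    a.2.exists_step (p := p) (q := q) (φ := φ) (s := s) (f := f) (σ := σ) (c := c) (τ := τ)
      (hΔpos _ a.2.one_le).le
  let validNext (a : {a : State n // a.Valid Δ}) : {a : State n // a.Valid Δ} :=
    ⟨next a, (hnext a).valid hΔpos a.2⟩
  let start : {a : State n // a.Valid Δ} :=
    ⟨⟨1, x₀, {x₀}⟩, State.valid_singleton le_rfl (hΔpos 1 le_rfl).le x₀⟩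
  refine ⟨fun t => (validNext^[t] start).1, rfl, fun t => ?_⟩
  simp only [Function.iterate_succ_apply']
  exact hnext _

theorem IsExecution.valid (he : IsExecution p q φ s f σ c Δ τ x₀ e)
    (hΔpos : ∀ j, 1 ≤ j → 0 < Δ j) (t : ℕ) : (e t).Valid Δ := by
  induction t with
  | zero => exact he.1 ▸ State.valid_singleton le_rfl (hΔpos 1 le_rfl).le x₀
  | succ t ih => exact (he.2 t).valid hΔpos ih

theorem IsExecution.antitone (he : IsExecution p q φ s f σ c Δ τ x₀ e)
    (hΔpos : ∀ j, 1 ≤ j → 0 < Δ j) (hτpos : ∀ j, 1 ≤ j → 0 < τ j) :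
    Antitone fun t => f (e t).x :=
  antitone_nat_of_succ_le fun t =>
    have hj := (he.valid hΔpos t).one_le
    (he.2 t).apply_le (hΔpos _ hj) (hτpos _ hj).le

theorem IsExecution.apply_le_of_isOuterIterate (he : IsExecution p q φ s f σ c Δ τ x₀ e)
    (hΔpos : ∀ j, 1 ≤ j → 0 < Δ j) (hτpos : ∀ j, 1 ≤ j → 0 < τ j) {j : ℕ} {y : Rn n}
    (hy : IsOuterIterate e j y) : f y ≤ f x₀ := by
  obtain ⟨t, -, -, rfl⟩ := hy
  simpa [he.1] using he.antitone hΔpos hτpos t.zero_le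

theorem IsExecution.not_forall_j_eq [TopologicalSpace S] [CompactSpace S]
    (he : IsExecution p q φ s f σ c Δ τ x₀ e) (hf : IsMaxRepr q φ f)
    (hs : IsActiveSelection φ f s) (hΔpos : ∀ j, 1 ≤ j → 0 < Δ j)
    (hτpos : ∀ j, 1 ≤ j → 0 < τ j) (hc : 0 < c) (hbelow : BddBelow (range f)) (N : ℕ) :
    ¬ ∀ t ≥ N, (e t).j = (e N).j := by
  intro hj
  have hjN := (he.valid hΔpos N).one_le
  have hδ : 0 < τ (e N).j * Δ (e N).j ^ p := mul_pos (hτpos _ hjN) (pow_pos (hΔpos _ hjN) p)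
  obtain ⟨M, hM⟩ := eventually_atTop.1 <| eventually_sub_lt_succ_of_antitone
    (he.antitone hΔpos hτpos) (hbelow.mono (range_comp_subset_range (fun t => (e t).x) f)) hδ
  have hnull : ∀ t ≥ max M N, IsNullStep q φ s f σ c Δ (e t) (e (t + 1)) := by
    intro t ht
    have hjt := hj t (le_of_max_le_right ht)
    have hsame : (e (t + 1)).j = (e t).j :=
      (hj _ (Nat.le_succ_of_le (le_of_max_le_right ht))).trans hjt.symm
    have hΔt := hΔpos _ (he.valid hΔpos t).one_le
    refine ((he.2 t).isNullStep_or_apply_le_sub hΔt hsame).resolve_right fun hle => ?_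
    rw [hjt] at hle
    exact hle.not_gt (hM t (le_of_max_le_left ht))
  exact not_forall_isNullStep hf hs hc (a := fun k => e (max M N + k))
    (hΔpos _ (he.valid hΔpos _).one_le) fun k => hnull _ (Nat.le_add_right _ _)

theorem IsExecution.existsUnique_isOuterIterate [TopologicalSpace S] [CompactSpace S]
    (he : IsExecution p q φ s f σ c Δ τ x₀ e) (hf : IsMaxRepr q φ f)
    (hs : IsActiveSelection φ f s) (hΔpos : ∀ j, 1 ≤ j → 0 < Δ j)
    (hτpos : ∀ j, 1 ≤ j → 0 < τ j) (hc : 0 < c) (hbelow : BddBelow (range f)) {j : ℕ}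
    (hj : 1 ≤ j) : ∃! y, IsOuterIterate e j y := by
  obtain ⟨t, ⟨ht, hsucc⟩, hunique⟩ := existsUnique_eq_and_succ_eq (u := fun t => (e t).j)
    (fun t => (he.2 t).j_eq_or) (he.not_forall_j_eq hf hs hΔpos hτpos hc hbelow)
    (k := j) (by simpa [he.1] using hj)
  refine ⟨(e t).x, ⟨t, ht, hsucc, rfl⟩, ?_⟩
  rintro _ ⟨t', ht', hsucc', rfl⟩
  rw [hunique t' ⟨ht', hsucc'⟩]

theorem IsExecution.Lam_le [TopologicalSpace S] [CompactSpace S]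
    (he : IsExecution p q φ s f σ c Δ τ x₀ e) (hf : IsMaxRepr q φ f) (hpq : p ≤ q + 1)
    (hΔpos : ∀ j, 1 ≤ j → 0 < Δ j) {K : Set (Rn n)} {C : ℝ≥0} (hC : IsTaylorConst q φ K C)
    {j : ℕ} {y : Rn n} (hy : IsOuterIterate e j y) (hK : closedBall y (Δ j) ⊆ K) :
    Lam f p y (Δ j) ≤
      τ j + (Δ j ^ ((q : ℝ) + σ - p) + C * 2 ^ (q + 1) * Δ j ^ (q + 1 - p)) := by
  obtain ⟨t, rfl, hsucc, rfl⟩ := hy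
  have hvalid := he.valid hΔpos t
  have hΔ₀ := hΔpos _ hvalid.one_le
  obtain ⟨-, z, hz, hacc, hexit⟩ := (he.2 t).exists_modelAccurate_of_succ hsucc
  set d := Δ (e t).j
  set η := d ^ ((q : ℝ) + σ) + C * (2 * d) ^ (q + 1) with hη
  have hη_div : η / d ^ p =
      d ^ ((q : ℝ) + σ - p) + C * 2 ^ (q + 1) * d ^ (q + 1 - p) := by
    rw [hη, add_div, mul_pow, Real.rpow_sub hΔ₀, Real.rpow_natCast,
      pow_sub₀ _ hΔ₀.ne' hpq]
    ring
  calc Lam f p (e t).x d ≤ (f (e t).x - (f z - η)) / d ^ p :=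
        Lam_le_div hf.locallyLipschitz.continuous hΔ₀.le fun w hw => sub_le_iff_le_add.2 <|
          hz.apply_le_add hacc hf hC hK ⟨_, hvalid.mem⟩ hvalid.mem_closedBall hw
    _ = (f (e t).x - f z) / d ^ p + η / d ^ p := by ring
    _ ≤ τ (e t).j + (d ^ ((q : ℝ) + σ - p) + C * 2 ^ (q + 1) * d ^ (q + 1 - p)) :=
        add_le_add hexit.le hη_div.le

theorem IsExecution.tendsto_Lam [TopologicalSpace S] [CompactSpace S]
    (he : IsExecution p q φ s f σ c Δ τ x₀ e) (hf : IsMaxRepr q φ f) (hpq : p ≤ q)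
    (hσ : (p : ℝ) < q + σ) (hΔpos : ∀ j, 1 ≤ j → 0 < Δ j) (hΔ : Tendsto Δ atTop (𝓝 0))
    (hτ : Tendsto τ atTop (𝓝 0)) {B : Set (Rn n)} (hB : Bornology.IsBounded B) {x : ℕ → Rn n}
    (hxB : ∀ᶠ j in atTop, x j ∈ B) (hx : ∀ᶠ j in atTop, IsOuterIterate e j (x j)) :
    Tendsto (fun j => Lam f p (x j) (Δ j)) atTop (𝓝 0) := by
  obtain ⟨R, hR⟩ := hB.subset_closedBall 0
  obtain ⟨C, hC⟩ := hf.exists_isTaylorConst (isCompact_closedBall 0 (1 + R))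
    (convex_closedBall 0 (1 + R))
  have hbound : Tendsto (fun j => τ j + (Δ j ^ ((q : ℝ) + σ - p) +
      C * 2 ^ (q + 1) * Δ j ^ (q + 1 - p))) atTop (𝓝 0) := by
    have hσ' : 0 < (q : ℝ) + σ - p := sub_pos.2 hσ
    have hpq' : q + 1 - p ≠ 0 := by lia
    simpa [Real.zero_rpow hσ'.ne', hpq'] using hτ.add ((hΔ.rpow_const (.inr hσ'.le)).add
      ((hΔ.pow (q + 1 - p)).const_mul (C * 2 ^ (q + 1) : ℝ)))
  refine squeeze_zero' ?_ ?_ hbound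
  · filter_upwards [eventually_ge_atTop 1] with j hj
    exact Lam_nonneg hf.locallyLipschitz.continuous (x j) (hΔpos j hj).le
  · filter_upwards [hxB, hx, hΔ.eventually_le_const one_pos] with j hjB hj hΔ₁
    exact he.Lam_le hf (Nat.le_succ_of_le hpq) hΔpos hC hj
      (closedBall_subset_closedBall' (add_le_add hΔ₁ (hR hjB)))

end Execution

end TRBundle

theorem mainTheorem1_general {n : ℕ} {S : Type*} [TopologicalSpace S] [CompactSpace S]
    (p q : ℕ) (hp : 1 ≤ p) (hpq : p ≤ q)
    (f : TRBundle.Rn n → ℝ) (φ : S → TRBundle.Rn n → ℝ) (hf : TRBundle.IsMaxRepr q φ f)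
    (s : TRBundle.Rn n → S) (hs : TRBundle.IsActiveSelection φ f s)
    (Δ τ : ℕ → ℝ) (hΔpos : ∀ j, 1 ≤ j → 0 < Δ j) (hΔ : Tendsto Δ atTop (𝓝 0))
    (hτpos : ∀ j, 1 ≤ j → 0 < τ j) (hτ : Tendsto τ atTop (𝓝 0))
    (σ c : ℝ) (hσ : (p : ℝ) < q + σ) (hc : 0 < c)
    (x₀ : TRBundle.Rn n) (hbdd : Bornology.IsBounded {x | f x ≤ f x₀}) :
    (∃ e, TRBundle.IsExecution p q φ s f σ c Δ τ x₀ e) ∧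
    ∀ e, TRBundle.IsExecution p q φ s f σ c Δ τ x₀ e →
      (∀ j, 1 ≤ j → ∃! y, TRBundle.IsOuterIterate e j y) ∧
      ∀ x : ℕ → TRBundle.Rn n, (∀ j, 1 ≤ j → TRBundle.IsOuterIterate e j (x j)) →
        Tendsto (fun j => TRBundle.Lam f p (x j) (Δ j)) atTop (𝓝 0) ∧
        (∃ a, MapClusterPt a atTop x) ∧
        ∀ a, MapClusterPt a atTop x → TRBundle.IsCritical f a := by
  have hfc := hf.locallyLipschitz.continuous
  have hbelow := TRBundle.bddBelow_range_of_isBounded_sublevel hfc hbdd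
  refine ⟨TRBundle.exists_isExecution hΔpos, fun e he => ⟨fun j hj => ?_, fun x hx => ?_⟩⟩
  · exact he.existsUnique_isOuterIterate hf hs hΔpos hτpos hc hbelow hj
  have hmem : ∀ j, 1 ≤ j → x j ∈ {y | f y ≤ f x₀} := fun j hj =>
    he.apply_le_of_isOuterIterate hΔpos hτpos (hx j hj)
  have hLam := he.tendsto_Lam hf hpq hσ hΔpos hΔ hτ hbdd (eventually_atTop.2 ⟨1, hmem⟩)
    (eventually_atTop.2 ⟨1, hx⟩)
  have hcluster : ∃ a, MapClusterPt a atTop x :=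
    have ⟨a, _, ha⟩ := (Metric.isCompact_of_isClosed_isBounded
      (isClosed_le hfc continuous_const) hbdd).exists_mapClusterPt
        (tendsto_principal.2 (eventually_atTop.2 ⟨1, hmem⟩))
    ⟨a, ha⟩
  have hΔ' : Tendsto Δ atTop (𝓝[>] 0) :=
    tendsto_nhdsWithin_iff.2 ⟨hΔ, eventually_atTop.2 ⟨1, hΔpos⟩⟩
  exact ⟨hLam, hcluster, fun a ha => TRBundle.isCritical_of_tendsto_Lam hfc hp hΔ' hLam ha⟩

theorem mainTheorem1 {n : ℕ} {S : Type*} [TopologicalSpace S] [CompactSpace S]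
    (p q : ℕ) (hp : 1 ≤ p) (hpq : p ≤ q)
    (f : TRBundle.Rn n → ℝ) (φ : S → TRBundle.Rn n → ℝ) (hf : TRBundle.IsMaxRepr q φ f)
    (s : TRBundle.Rn n → S) (hs : TRBundle.IsActiveSelection φ f s)
    (Δ τ : ℕ → ℝ) (hΔpos : ∀ j, 1 ≤ j → 0 < Δ j) (hΔ : Tendsto Δ atTop (𝓝 0))
    (hτpos : ∀ j, 1 ≤ j → 0 < τ j) (hτ : Tendsto τ atTop (𝓝 0))
    (σ c : ℝ) (hσ : σ ∈ Set.Ioo (0 : ℝ) 1) (hc : 0 < c)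
    (x₀ : TRBundle.Rn n) (hbdd : Bornology.IsBounded {x | f x ≤ f x₀}) :
    -- the method can be carried out
    (∃ e, TRBundle.IsExecution p q φ s f σ c Δ τ x₀ e) ∧
    ∀ e, TRBundle.IsExecution p q φ s f σ c Δ τ x₀ e →
      -- all inner loops terminate, and determine the sequence of outer iterates
      (∀ j, 1 ≤ j → ∃! y, TRBundle.IsOuterIterate e j y) ∧
      ∀ x : ℕ → TRBundle.Rn n, (∀ j, 1 ≤ j → TRBundle.IsOuterIterate e j (x j)) →
        Tendsto (fun j => TRBundle.Lam f p (x j) (Δ j)) atTop (𝓝 0) ∧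
        (∃ a, MapClusterPt a atTop x) ∧
        ∀ a, MapClusterPt a atTop x → TRBundle.IsCritical f a :=
  mainTheorem1_general p q hp hpq f φ hf s hs Δ τ hΔpos hΔ hτpos hτ σ c
    (lt_add_of_le_of_pos (mod_cast hpq) hσ.1) hc x₀ hbdd
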